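/- Let $N\ge 2$ and let $\Omega\subset\mathbb{R}^N$ be a bounded domain, i.e. a bounded, nonempty, connected open set (no regularity of the boundary is needed; in particular $\Omega$ may be any bounded smooth domain). Let $d_\Omega(x)=\inf_{y\in\partial\Omega}|x-y|$ for $x\in\overline\Omega$, and let $\|\cdot\|_s$ denote the norm of $L^s(\Omega)$. Let $W_0^{1,p}(\Omega)$ be the closure of $C_c^\infty(\Omega)$ in $W^{1,p}(\Omega)$. For $p>N$ and $1\le q<\infty$ put $$\lambda_{p,q}:=\inf\left\{\|\nabla u\|_p^p : u\in W_0^{1,p}(\Omega),\ \|u\|_q=1\right\}.$$ A Sobolev extremal function corresponding to $\lambda_{p,q}$ is a function $u\in W_0^{1,p}(\Omega)$ (identified with its representative continuous on $\overline\Omega$) with $u>0$ in $\Omega$, $\|u\|_q=1$ and $\|\nabla u\|_p^p=\lambda_{p,q}$. Let $q:(N,\infty)\to[1,\infty)$ be a function such that $q(p)\to r<\infty$ as $p\to\infty$. Then $$\lim_{p\to\infty}\lambda_{p,q(p)}^{1/p}=\|d_\Omega\|_r^{-1}.$$ Moreover, if for each $p>N$ the function $u_{p,q(p)}$ is any Sobolev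 extremal function corresponding to $\lambda_{p,q(p)}$, then the whole family converges: $$\lim_{p\to\infty}u_{p,q(p)}=\frac{d_\Omega}{\|d_\Omega\|_r}\quad\text{uniformly in }\overline\Omega.$$ -/

import Mathlib

open MeasureTheory Filter Topology
open scoped ContDiff Gradient

noncomputable section

namespace SobolevExtremal

/-- The Euclidean space `ℝ^N`. -/
abbrev Eucl (N : ℕ) : Type := EuclideanSpace ℝ (Fin N)

/-- `φ ∈ C_c^∞(Ω)`: smooth, with compact support contained in `Ω`. -/
structure IsTestFunction {N : ℕ} (Ω : Set (Eucl N)) (φ : Eucl N → ℝ) : Prop where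
  contDiff : ContDiff ℝ ∞ φ
  hasCompactSupport : HasCompactSupport φ
  tsupport_subset : tsupport φ ⊆ Ω

/-- `V` is a weak (distributional) gradient of `u` in `Ω`:
`∫_Ω u ∇φ = - ∫_Ω φ V` for all `φ ∈ C_c^∞(Ω)`. -/
structure HasWeakGradient {N : ℕ} (Ω : Set (Eucl N)) (u : Eucl N → ℝ) (V : Eucl N → Eucl N) :
    Prop where
  locallyIntegrableOn : LocallyIntegrableOn u Ω
  locallyIntegrableOn_gradient : LocallyIntegrableOn V Ω
  integral_eq : ∀ φ : Eucl N → ℝ, IsTestFunction Ω φ →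
    ∫ x in Ω, u x • ∇ φ x = - ∫ x in Ω, φ x • V x

/-- `u ∈ W_0^{1,p}(Ω)` with weak gradient `V`: `u` and its weak gradient `V` are in `L^p(Ω)`, and
`u` is a limit of functions of `C_c^∞(Ω)` in the norm of `W^{1,p}(Ω)`. -/
structure MemW01p {N : ℕ} (Ω : Set (Eucl N)) (p : ℝ) (u : Eucl N → ℝ) (V : Eucl N → Eucl N) :
    Prop where
  memLp : MemLp u (ENNReal.ofReal p) (volume.restrict Ω)
  memLp_gradient : MemLp V (ENNReal.ofReal p) (volume.restrict Ω)
  hasWeakGradient : HasWeakGradient Ω u V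
  exists_approx : ∃ φ : ℕ → Eucl N → ℝ, (∀ n, IsTestFunction Ω (φ n)) ∧
    Tendsto (fun n => eLpNorm (fun x => φ n x - u x) (ENNReal.ofReal p) (volume.restrict Ω))
      atTop (𝓝 0) ∧
    Tendsto (fun n => eLpNorm (fun x => ∇ (φ n) x - V x) (ENNReal.ofReal p) (volume.restrict Ω))
      atTop (𝓝 0)

/-- The standard norm of `L^s(Ω)`, for functions belonging to that space. -/
def normL {N : ℕ} {F : Type*} [NormedAddCommGroup F] (Ω : Set (Eucl N)) (s : ℝ) (f : Eucl N → F) :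
    ℝ :=
  (eLpNorm f (ENNReal.ofReal s) (volume.restrict Ω)).toReal

/-- `λ_{p,q}`, the infimum of `‖∇u‖_p^p` over `u ∈ W_0^{1,p}(Ω)` with `‖u‖_q = 1`. -/
def sobolevConst {N : ℕ} (Ω : Set (Eucl N)) (p q : ℝ) : ℝ :=
  sInf {t : ℝ | ∃ (u : Eucl N → ℝ) (V : Eucl N → Eucl N),
    MemW01p Ω p u V ∧ normL Ω q u = 1 ∧ t = normL Ω p V ^ p}

/-- `u` is (the representative continuous on the closure of `Ω` of) a Sobolev extremal function
corresponding to `λ_{p,q}`: a positive minimizer in the definition of `λ_{p,q}`. -/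
structure IsSobolevExtremal {N : ℕ} (Ω : Set (Eucl N)) (p q : ℝ) (u : Eucl N → ℝ) : Prop where
  continuousOn : ContinuousOn u (closure Ω)
  pos : ∀ x ∈ Ω, 0 < u x
  norm_eq_one : normL Ω q u = 1
  isMinimizer : ∃ V : Eucl N → Eucl N, MemW01p Ω p u V ∧ normL Ω p V ^ p = sobolevConst Ω p q

/-- The distance function to the boundary of `Ω`. -/
def distBdry {N : ℕ} (Ω : Set (Eucl N)) (x : Eucl N) : ℝ :=
  Metric.infDist x (frontier Ω)

end SobolevExtremal

end

/-! As p → ∞ a bound on ‖∇u‖_p turns into a Lipschitz bound. Among functions vanishing on ∂Ω with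
Lipschitz constant L the largest is L d_Ω, so the least L compatible with norm 1 is 1/‖d_Ω‖_r, and L
d_Ω is then the only nonnegative competitor.

This is made quantitative by Morrey's inequality in the form |u(x) - u(y)| ≤ K_p (|x - y| + N/p)
‖∇u‖_p with K_p → 1 (`abs_sub_le_morreyConst_mul`), carried over to W_0^{1,p} by density. Taking y
to be a nearest boundary point gives |u| ≤ K_p (d_Ω + N/p) ‖∇u‖_p, and L^q norms of both sides bound
λ from below (`le_sobolevConst`). Mollified truncations of d_Ω, normalised in L^q, bound it from
above (`IsTestFunction.sobolevConst_le`).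

Extremals satisfy u_p ≤ w_p = κ_p (d_Ω + N/p) with κ_p → 1/‖d_Ω‖_r, while ∫ u_p^q = 1 and ∫ w_p^q →
1. If u_p fell short of the limit by ε at one point, Morrey's inequality would spread the deficit
over a ball of fixed radius, and superadditivity of t ↦ t^q would keep ∫ w_p^q above 1 by a fixed
margin. The margin does not depend on the point, so convergence is uniform and no subsequence is
extracted. -/

noncomputable section

namespace SobolevExtremal

/-! ### Morrey's inequality with a constant tending to 1 -/

/-- Hölder's inequality on a ball of radius `s`, rescaled to the unit ball. -/
lemma setIntegral_closedBall_comp_le {N : ℕ} {g : Eucl N → ℝ} (hg : Continuous g)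
    (hg0 : ∀ x, 0 ≤ g x) {p : ℝ} (hp : 1 < p) (hgp : Integrable (fun x => g x ^ p))
    (c : Eucl N) {s : ℝ} (hs : 0 < s) :
    ∫ z in Metric.closedBall (0 : Eucl N) 1, g (c + s • z) ≤
      volume.real (Metric.closedBall (0 : Eucl N) 1) ^ (1 - 1 / p) *
        (s ^ (-(N : ℝ) / p) * (∫ x, g x ^ p) ^ (1 / p)) := by
  set B := Metric.closedBall (0 : Eucl N) 1
  have hB : IsCompact B := isCompact_closedBall _ _
  have : IsFiniteMeasure (volume.restrict B) := ⟨by simpa using hB.measure_lt_top⟩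
  have hc : Continuous fun z => g (c + s • z) := by fun_prop
  have hconj : p.HolderConjugate (p.conjExponent) := Real.HolderConjugate.conjExponent hp
  obtain ⟨M, hM⟩ := hB.exists_bound_of_continuousOn hc.continuousOn
  have h1 := integral_mul_le_Lp_mul_Lq_of_nonneg (μ := volume.restrict B) hconj
    (f := fun z => g (c + s • z)) (g := fun _ => 1)
    (Eventually.of_forall fun z => hg0 _) (Eventually.of_forall fun z => zero_le_one)
    (MemLp.of_bound hc.aestronglyMeasurable M
      ((ae_restrict_iff' hB.measurableSet).2 (Eventually.of_forall hM)))
    (memLp_const _)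
  have h2 : ∫ z in B, g (c + s • z) ^ p ≤ s ^ (-(N : ℝ)) * ∫ x, g x ^ p := by
    have hi : Integrable fun z => g (c + s • z) ^ p :=
      (hgp.comp_add_left c).comp_smul hs.ne'
    have := setIntegral_le_integral (s := B) hi
      (Eventually.of_forall fun z => Real.rpow_nonneg (hg0 _) _)
    refine this.trans_eq ?_
    rw [Measure.integral_comp_smul volume (fun z => g (c + z) ^ p) s,
      integral_add_left_eq_self (fun z => g z ^ p) c, finrank_euclideanSpace_fin,
      abs_of_pos (by positivity), smul_eq_mul, Real.rpow_neg hs.le, Real.rpow_natCast]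
  have h3 : (∫ z in B, (1 : ℝ) ^ p.conjExponent) = volume.real B := by simp
  have h4 : 1 / p.conjExponent = 1 - 1 / p := by
    have := hconj.inv_add_inv_eq_one
    rw [one_div, one_div]; linarith
  simp only [mul_one] at h1
  rw [h3, h4] at h1
  refine h1.trans ?_
  rw [mul_comm]
  refine mul_le_mul_of_nonneg_left ?_ (by positivity)
  refine (Real.rpow_le_rpow (setIntegral_nonneg hB.measurableSet
    fun z _ => Real.rpow_nonneg (hg0 _) _) h2 (by positivity)).trans_eq ?_
  rw [Real.mul_rpow (by positivity) (integral_nonneg fun z => Real.rpow_nonneg (hg0 _) _),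
    ← Real.rpow_mul hs.le]
  congr 2
  ring

/-- Comparison of a value of `φ` with its average over a ball of radius `R` around `m`. -/
lemma abs_setIntegral_sub_le {N : ℕ} {φ : Eucl N → ℝ} (hφ : ContDiff ℝ 1 φ)
    (hφc : HasCompactSupport φ) {p : ℝ} (hp : (N : ℝ) < p) (hp1 : 1 < p) (x m : Eucl N) {R : ℝ}
    (hR : 0 < R) :
    |∫ z in Metric.closedBall (0 : Eucl N) 1, (φ (m + R • z) - φ x)| ≤
      (‖m - x‖ + R) * (volume.real (Metric.closedBall (0 : Eucl N) 1) ^ (1 - 1 / p) *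
        (R ^ (-(N : ℝ) / p) * (∫ x, ‖fderiv ℝ φ x‖ ^ p) ^ (1 / p)) / (1 - N / p)) := by
  set B := Metric.closedBall (0 : Eucl N) 1
  set G := (∫ x, ‖fderiv ℝ φ x‖ ^ p) ^ (1 / p)
  set w := volume.real B
  have hp0 : 0 < p := by linarith
  have hB : IsCompact B := isCompact_closedBall _ _
  have hfd : Continuous (fderiv ℝ φ) := hφ.continuous_fderiv one_ne_zero
  have hgc : Continuous fun x => ‖fderiv ℝ φ x‖ := hfd.norm
  have hgp : Integrable fun x => ‖fderiv ℝ φ x‖ ^ p := by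
    refine Continuous.integrable_of_hasCompactSupport
      (hgc.rpow_const fun _ => Or.inr hp0.le) ?_
    refine (hφc.fderiv (𝕜 := ℝ)).comp_left (g := fun L => ‖L‖ ^ p) ?_
    simp [hp0.ne']
  -- The segment from x to m + R z is followed at constant velocity (m - x) + R z. At time t, as z
  -- runs over the unit ball, its points fill a ball of radius t R, to which the rescaled Hölder
  -- inequality applies.
  have hpt : ∀ z ∈ B, |φ (m + R • z) - φ x| ≤
      ∫ t in (0 : ℝ)..1, (‖m - x‖ + R) * ‖fderiv ℝ φ ((x + t • (m - x)) + (t * R) • z)‖ := by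
    intro z hz
    have hz1 : ‖z‖ ≤ 1 := by simpa [B] using hz
    have hder : ∀ t : ℝ, HasDerivAt (fun t : ℝ => φ ((x + t • (m - x)) + (t * R) • z))
        (fderiv ℝ φ ((x + t • (m - x)) + (t * R) • z) ((m - x) + R • z)) t := by
      intro t
      have hin : HasDerivAt (fun t : ℝ => (x + t • (m - x)) + (t * R) • z)
          ((m - x) + R • z) t := by
        have h1 := ((hasDerivAt_id t).smul_const (m - x)).const_add x
        have h2 := ((hasDerivAt_id t).mul_const R).smul_const z
        refine (h1.add h2).congr_deriv ?_
        simp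
      exact ((hφ.differentiable one_ne_zero _).hasFDerivAt).comp_hasDerivAt t hin
    have hcont : Continuous fun t : ℝ =>
        fderiv ℝ φ ((x + t • (m - x)) + (t * R) • z) ((m - x) + R • z) :=
      (hfd.comp (by fun_prop)).clm_apply continuous_const
    have hint := intervalIntegral.integral_eq_sub_of_hasDerivAt (a := 0) (b := 1)
      (fun t _ => hder t) (hcont.intervalIntegrable _ _)
    have he : φ (m + R • z) - φ x =
        ∫ t in (0 : ℝ)..1, fderiv ℝ φ ((x + t • (m - x)) + (t * R) • z) ((m - x) + R • z) := by
      rw [hint]; simp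
    rw [he, ← Real.norm_eq_abs]
    refine intervalIntegral.norm_integral_le_of_norm_le zero_le_one
      (Eventually.of_forall fun t _ => ?_) (Continuous.intervalIntegrable (by fun_prop) _ _)
    refine (ContinuousLinearMap.le_opNorm _ _).trans ?_
    rw [mul_comm]
    refine mul_le_mul_of_nonneg_right ((norm_add_le _ _).trans ?_) (norm_nonneg _)
    rw [norm_smul, Real.norm_eq_abs, abs_of_pos hR]
    nlinarith
  have hprod : Continuous (Function.uncurry fun (t : ℝ) (z : Eucl N) =>
      (‖m - x‖ + R) * ‖fderiv ℝ φ ((x + t • (m - x)) + (t * R) • z)‖) := by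
    simp only [Function.uncurry_def]
    fun_prop
  have hprodI : Integrable (Function.uncurry fun (t : ℝ) (z : Eucl N) =>
      (‖m - x‖ + R) * ‖fderiv ℝ φ ((x + t • (m - x)) + (t * R) • z)‖)
      ((volume.restrict (Set.uIoc (0 : ℝ) 1)).prod (volume.restrict B)) := by
    rw [Measure.prod_restrict]
    have := (hprod.continuousOn (s := Set.Icc (0 : ℝ) 1 ×ˢ B)).integrableOn_compact
      (μ := (volume : Measure ℝ).prod (volume : Measure (Eucl N))) (isCompact_Icc.prod hB)
    refine this.mono_set (Set.prod_mono ?_ subset_rfl)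
    rw [Set.uIoc_of_le zero_le_one]
    exact Set.Ioc_subset_Icc_self
  have hφcont := hφ.continuous
  rw [← Real.norm_eq_abs]
  refine (norm_integral_le_integral_norm _).trans ?_
  have hle : ∫ z in B, ‖φ (m + R • z) - φ x‖ ≤ ∫ z in B, ∫ t in (0 : ℝ)..1,
      (‖m - x‖ + R) * ‖fderiv ℝ φ ((x + t • (m - x)) + (t * R) • z)‖ := by
    refine setIntegral_mono_on ?_ ?_ hB.measurableSet hpt
    · exact ContinuousOn.integrableOn_compact hB (Continuous.continuousOn (by fun_prop))
    · refine ContinuousOn.integrableOn_compact hB (Continuous.continuousOn ?_)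
      refine intervalIntegral.continuous_parametric_intervalIntegral_of_continuous' ?_ 0 1
      simp only [Function.uncurry_def]
      fun_prop
  refine hle.trans ?_
  rw [← intervalIntegral_integral_swap hprodI]
  have hθ : (N : ℝ) / p < 1 := (div_lt_one hp0).2 hp
  -- This is where p > N enters: t ^ (-N/p) is integrable at 0, with integral 1 / (1 - N/p) over (0,
  -- 1).
  have hexp : (-1 : ℝ) < -(N : ℝ) / p := by rw [neg_div]; linarith
  have hslice : ∀ t ∈ Set.Ioo (0 : ℝ) 1,
      ∫ z in B, (‖m - x‖ + R) * ‖fderiv ℝ φ ((x + t • (m - x)) + (t * R) • z)‖ ≤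
      ((‖m - x‖ + R) * (w ^ (1 - 1 / p) * (R ^ (-(N : ℝ) / p) * G))) * t ^ (-(N : ℝ) / p) := by
    intro t ht
    rw [integral_const_mul, mul_assoc]
    refine mul_le_mul_of_nonneg_left ?_ (by positivity)
    refine (setIntegral_closedBall_comp_le hgc (fun _ => norm_nonneg _) hp1 hgp
      (x + t • (m - x)) (mul_pos ht.1 hR)).trans_eq ?_
    rw [Real.mul_rpow ht.1.le hR.le]
    ring
  have hmono := intervalIntegral.integral_mono_on_of_le_Ioo (μ := volume) zero_le_one
    ?_ ?_ hslice
  · refine hmono.trans_eq ?_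
    rw [intervalIntegral.integral_const_mul, integral_rpow (Or.inl hexp), Real.one_rpow,
      Real.zero_rpow (by linarith), neg_div]
    have : (1 : ℝ) - N / p ≠ 0 := by linarith
    have h' : -((N : ℝ) / p) + 1 = 1 - N / p := by ring
    rw [h']
    ring
  · rw [intervalIntegrable_iff]
    exact hprodI.integral_prod_left
  · exact (intervalIntegral.intervalIntegrable_rpow' hexp).const_mul _

/-- The constant in the Morrey inequality below; it tends to `1` as `p → ∞`. -/
def morreyConst (N : ℕ) (p : ℝ) : ℝ :=
  (1 + 1 / p) * volume.real (Metric.closedBall (0 : Eucl N) 1) ^ (-(1 / p)) *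
    (2 * p) ^ ((N : ℝ) / p) / (1 - N / p)

lemma morreyConst_pos {N : ℕ} {p : ℝ} (hp : (N : ℝ) < p) : 0 < morreyConst N p := by
  have hp0 : 0 < p := N.cast_nonneg.trans_lt hp
  have : (N : ℝ) / p < 1 := (div_lt_one hp0).2 hp
  have h1 : 0 < 1 - (N : ℝ) / p := by linarith
  have hw : 0 < volume.real (Metric.closedBall (0 : Eucl N) 1) :=
    ENNReal.toReal_pos (Metric.measure_closedBall_pos _ _ one_pos).ne'
      (isCompact_closedBall _ _).measure_lt_top.ne
  unfold morreyConst
  positivity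

/-- The only factor with a growing base is (2p)^(N/p), and it is a bounded factor times a power of
p^(1/p) → 1. -/
lemma tendsto_morreyConst (N : ℕ) : Tendsto (morreyConst N) atTop (𝓝 1) := by
  have hw : 0 < volume.real (Metric.closedBall (0 : Eucl N) 1) :=
    ENNReal.toReal_pos (Metric.measure_closedBall_pos _ _ one_pos).ne'
      (isCompact_closedBall _ _).measure_lt_top.ne
  have h0 : Tendsto (fun p : ℝ => 1 / p) atTop (𝓝 0) := by
    simpa using tendsto_inv_atTop_zero
  have hN : Tendsto (fun p : ℝ => (N : ℝ) / p) atTop (𝓝 0) := tendsto_const_nhds.div_atTop tendsto_id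
  have h1 : Tendsto (fun p : ℝ => volume.real (Metric.closedBall (0 : Eucl N) 1) ^ (-(1 / p)))
      atTop (𝓝 1) := by
    have := (tendsto_const_nhds (x := volume.real (Metric.closedBall (0 : Eucl N) 1))).rpow
      h0.neg (Or.inl hw.ne')
    simpa using this
  have h2 : Tendsto (fun p : ℝ => (2 * p) ^ ((N : ℝ) / p)) atTop (𝓝 1) := by
    have ha : Tendsto (fun p : ℝ => (2 : ℝ) ^ ((N : ℝ) / p)) atTop (𝓝 1) := by
      simpa using (tendsto_const_nhds (x := (2 : ℝ))).rpow hN (Or.inl two_ne_zero)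
    have hb : Tendsto (fun p : ℝ => (p ^ (1 / p)) ^ (N : ℝ)) atTop (𝓝 1) := by
      simpa using tendsto_rpow_div.rpow_const (p := (N : ℝ)) (Or.inl one_ne_zero)
    have hc := ha.mul hb
    rw [one_mul] at hc
    refine hc.congr' ?_
    filter_upwards [eventually_gt_atTop 0] with p hp
    rw [Real.mul_rpow two_pos.le hp.le, ← Real.rpow_mul hp.le]
    congr 2
    ring
  have := (((tendsto_const_nhds (x := (1 : ℝ))).add h0).mul h1 |>.mul h2).div
    ((tendsto_const_nhds (x := (1 : ℝ))).sub hN) (by norm_num)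
  simp only [add_zero, sub_zero, mul_one, div_one] at this
  exact this

/-- Morrey's inequality with an asymptotically sharp constant. -/
lemma abs_sub_le_morreyConst_mul {N : ℕ} {φ : Eucl N → ℝ} (hφ : ContDiff ℝ 1 φ)
    (hφc : HasCompactSupport φ) {p : ℝ} (hp : (N : ℝ) < p) (hp1 : 1 < p) (x y : Eucl N) :
    |φ x - φ y| ≤
      morreyConst N p * (dist x y + N / p) * (∫ x, ‖fderiv ℝ φ x‖ ^ p) ^ (1 / p) := by
  have hp0 : 0 < p := by linarith
  have hG : 0 ≤ (∫ x, ‖fderiv ℝ φ x‖ ^ p) ^ (1 / p) :=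
    Real.rpow_nonneg (integral_nonneg fun _ => by positivity) _
  have hK := (morreyConst_pos hp).le
  rcases eq_or_ne x y with rfl | hxy
  · simp only [sub_self, abs_zero]; positivity
  set B := Metric.closedBall (0 : Eucl N) 1 with hBdef
  set G := (∫ x, ‖fderiv ℝ φ x‖ ^ p) ^ (1 / p)
  have hB : IsCompact B := isCompact_closedBall _ _
  have hw : 0 < volume.real B :=
    ENNReal.toReal_pos (Metric.measure_closedBall_pos _ _ one_pos).ne' hB.measure_lt_top.ne
  set w := volume.real B with hwdef
  set ρ := dist x y
  have hρ : 0 < ρ := dist_pos.2 hxy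
  -- A compromise: each path has length at most (ρ/2)(1 + 1/p), nearly half the distance, while the
  -- small radius costs only the factor (2p)^(N/p) → 1.
  set R := ρ / (2 * p)
  have hR : 0 < R := by positivity
  set m := midpoint ℝ x y
  have hmx : ‖m - x‖ = ρ / 2 := by
    rw [← dist_eq_norm, dist_midpoint_left]
    simp [ρ]; ring
  have hmy : ‖m - y‖ = ρ / 2 := by
    rw [← dist_eq_norm, dist_midpoint_right]
    simp [ρ]; ring
  have h1 := abs_setIntegral_sub_le hφ hφc hp hp1 x m hR
  have h2 := abs_setIntegral_sub_le hφ hφc hp hp1 y m hR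
  rw [hmx] at h1
  rw [hmy] at h2
  have hφcont := hφ.continuous
  have hI : IntegrableOn (fun z => φ (m + R • z)) B :=
    (Continuous.continuousOn (by fun_prop)).integrableOn_compact hB
  have hc : ∀ a : ℝ, IntegrableOn (fun _ : Eucl N => a) B := fun a =>
    continuousOn_const.integrableOn_compact hB
  rw [integral_sub hI (hc _), setIntegral_const, smul_eq_mul, ← hBdef, ← hwdef] at h1 h2
  set T := (ρ / 2 + R) * (w ^ (1 - 1 / p) * (R ^ (-(N : ℝ) / p) * G) / (1 - N / p)) with hT
  -- The average over the ball at the midpoint cancels between the two estimates.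
  have h3 : w * |φ x - φ y| ≤ 2 * T := by
    rw [← abs_of_pos hw, ← abs_mul]
    rw [abs_le] at h1 h2 ⊢
    constructor <;> linarith [h1.1, h1.2, h2.1, h2.2]
  have hθ : (N : ℝ) / p < 1 := (div_lt_one hp0).2 hp
  have h4 : 2 * T = w * (morreyConst N p * ρ ^ (1 - (N : ℝ) / p) * G) := by
    have e1 : w ^ (1 - 1 / p) = w * w ^ (-(1 / p)) := by
      rw [sub_eq_add_neg, Real.rpow_add hw, Real.rpow_one]
    have e2 : ρ ^ (1 - (N : ℝ) / p) = ρ * ρ ^ (-(N : ℝ) / p) := by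
      rw [sub_eq_add_neg, Real.rpow_add hρ, Real.rpow_one, neg_div]
    have e3 : R ^ (-(N : ℝ) / p) = ρ ^ (-(N : ℝ) / p) * (2 * p) ^ ((N : ℝ) / p) := by
      rw [Real.div_rpow hρ.le (by positivity), neg_div, Real.rpow_neg (x := 2 * p) (by positivity),
        div_inv_eq_mul]
    rw [hT, e1, e2, e3, morreyConst, ← hBdef, ← hwdef]
    have : R = ρ / 2 * (1 / p) := by simp only [R]; field_simp
    rw [this]
    ring
  -- Weighted AM-GM between ρ and 1 replaces the Hölder modulus by a linear one with additive error
  -- N/p.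
  have h5 : ρ ^ (1 - (N : ℝ) / p) ≤ ρ + N / p := by
    have := Real.geom_mean_le_arith_mean2_weighted (w₁ := 1 - (N : ℝ) / p) (w₂ := (N : ℝ) / p)
      (p₁ := ρ) (p₂ := 1) (by linarith) (by positivity) hρ.le zero_le_one (by ring)
    rw [Real.one_rpow, mul_one, mul_one] at this
    refine this.trans ?_
    have : 0 ≤ (N : ℝ) / p * ρ := by positivity
    linarith
  rw [h4] at h3
  refine (le_of_mul_le_mul_left h3 hw).trans ?_
  gcongr

/-! ### From test functions to W_0^{1,p} -/

lemma norm_gradient_eq {N : ℕ} (φ : Eucl N → ℝ) (x : Eucl N) : ‖∇ φ x‖ = ‖fderiv ℝ φ x‖ :=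
  LinearIsometryEquiv.norm_map _ _

lemma IsTestFunction.continuous_gradient {N : ℕ} {Ω : Set (Eucl N)} {φ : Eucl N → ℝ}
    (hφ : IsTestFunction Ω φ) : Continuous (∇ φ) :=
  (LinearIsometryEquiv.continuous _).comp (hφ.contDiff.continuous_fderiv (by simp))

lemma IsTestFunction.hasCompactSupport_gradient {N : ℕ} {Ω : Set (Eucl N)} {φ : Eucl N → ℝ}
    (hφ : IsTestFunction Ω φ) : HasCompactSupport (∇ φ) :=
  (hφ.hasCompactSupport.fderiv (𝕜 := ℝ)).comp_left (map_zero _)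

lemma IsTestFunction.eq_zero_of_notMem {N : ℕ} {Ω : Set (Eucl N)} {φ : Eucl N → ℝ}
    (hφ : IsTestFunction Ω φ) {x : Eucl N} (hx : x ∉ Ω) : φ x = 0 :=
  image_eq_zero_of_notMem_tsupport fun h => hx (hφ.tsupport_subset h)

lemma IsTestFunction.fderiv_eq_zero_of_notMem {N : ℕ} {Ω : Set (Eucl N)} {φ : Eucl N → ℝ}
    (hφ : IsTestFunction Ω φ) {x : Eucl N} (hx : x ∉ Ω) : fderiv ℝ φ x = 0 := by
  by_contra h
  exact hx (hφ.tsupport_subset (support_fderiv_subset ℝ h))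

lemma IsTestFunction.gradient_eq_zero_of_notMem {N : ℕ} {Ω : Set (Eucl N)} {φ : Eucl N → ℝ}
    (hφ : IsTestFunction Ω φ) {x : Eucl N} (hx : x ∉ Ω) : ∇ φ x = 0 := by
  rw [← norm_eq_zero, norm_gradient_eq, hφ.fderiv_eq_zero_of_notMem hx, norm_zero]

lemma IsTestFunction.normL_gradient {N : ℕ} {Ω : Set (Eucl N)} {φ : Eucl N → ℝ}
    (hφ : IsTestFunction Ω φ) {p : ℝ} (hp : 0 < p) :
    normL Ω p (∇ φ) = (∫ x, ‖fderiv ℝ φ x‖ ^ p) ^ (1 / p) := by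
  have hm : MemLp (∇ φ) (ENNReal.ofReal p) (volume.restrict Ω) :=
    (hφ.continuous_gradient.memLp_of_hasCompactSupport hφ.hasCompactSupport_gradient).restrict _
  rw [normL, hm.eLpNorm_eq_integral_rpow_norm (by simpa using hp) (by simp),
    ENNReal.toReal_ofReal (Real.rpow_nonneg (integral_nonneg fun _ => by positivity) _),
    ENNReal.toReal_ofReal hp.le, one_div]
  congr 1
  rw [setIntegral_eq_integral_of_forall_compl_eq_zero]
  · simp only [norm_gradient_eq]
  · intro x hx
    rw [hφ.gradient_eq_zero_of_notMem hx, norm_zero, Real.zero_rpow hp.ne']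

/-- Morrey's inequality in `W_0^{1,p}(Ω)`: almost everywhere `u` is the pointwise limit of test
functions satisfying Morrey's inequality. -/
lemma MemW01p.exists_seq_tendsto {N : ℕ} {Ω : Set (Eucl N)} {p : ℝ} {u : Eucl N → ℝ}
    {V : Eucl N → Eucl N} (h : MemW01p Ω p u V) (hp : (N : ℝ) < p) (hp1 : 1 < p) :
    ∃ φ : ℕ → Eucl N → ℝ, (∀ n, IsTestFunction Ω (φ n)) ∧
      (∀ᵐ x ∂(volume.restrict Ω), Tendsto (fun n => φ n x) atTop (𝓝 (u x))) ∧
      ∃ a : ℕ → ℝ, Tendsto a atTop (𝓝 (normL Ω p V)) ∧ ∀ n x y, |φ n x - φ n y| ≤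
        morreyConst N p * (dist x y + N / p) * a n := by
  obtain ⟨φ, hφ, h1, h2⟩ := h.exists_approx
  have hp0 : 0 < p := by linarith
  have hpe : ENNReal.ofReal p ≠ 0 := by simpa using hp0
  have hm := tendstoInMeasure_of_tendsto_eLpNorm (μ := volume.restrict Ω) (f := φ) (g := u) hpe
    (fun n => (hφ n).contDiff.continuous.aestronglyMeasurable) h.memLp.1 h1
  obtain ⟨ns, hns, hae⟩ := hm.exists_seq_tendsto_ae
  -- The bound a n comes from the triangle inequality ‖∇φ‖ ≤ ‖∇φ - V‖ + ‖V‖, whose first term tends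
  -- to 0.
  refine ⟨fun n => φ (ns n), fun n => hφ _, hae,
    fun n => normL Ω p (fun x => ∇ (φ (ns n)) x - V x) + normL Ω p V, ?_, ?_⟩
  · have := ((ENNReal.tendsto_toReal ENNReal.zero_ne_top).comp h2).comp hns.tendsto_atTop
    simpa [normL, Function.comp_def] using this.add_const (normL Ω p V)
  · intro n x y
    have hc := hφ (ns n)
    have hmg : MemLp (∇ (φ (ns n))) (ENNReal.ofReal p) (volume.restrict Ω) :=
      (hc.continuous_gradient.memLp_of_hasCompactSupport hc.hasCompactSupport_gradient).restrict _
    have := abs_sub_le_morreyConst_mul (hc.contDiff.of_le (by norm_cast))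
      hc.hasCompactSupport hp hp1 x y
    rw [← hc.normL_gradient hp0] at this
    refine this.trans ?_
    have hK := (morreyConst_pos hp).le
    refine mul_le_mul_of_nonneg_left ?_ (by positivity)
    have hsub : MemLp (fun x => ∇ (φ (ns n)) x - V x) _ _ := hmg.sub h.memLp_gradient
    simp only [normL]
    rw [← ENNReal.toReal_add hsub.2.ne h.memLp_gradient.2.ne]
    refine ENNReal.toReal_mono (ENNReal.add_ne_top.2 ⟨hsub.2.ne, h.memLp_gradient.2.ne⟩) ?_
    have hadd := eLpNorm_add_le (hmg.sub h.memLp_gradient).1 h.memLp_gradient.1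
      (p := ENNReal.ofReal p)
      (by simpa using hp1.le)
    rwa [sub_add_cancel] at hadd

/-- Almost everywhere bound of `W_0^{1,p}` functions by the distance to the boundary. -/
lemma MemW01p.abs_le_ae {N : ℕ} {Ω : Set (Eucl N)} (hΩ : IsOpen Ω) (hfr : IsCompact (frontier Ω))
    (hne : (frontier Ω).Nonempty) {p : ℝ} {u : Eucl N → ℝ}
    {V : Eucl N → Eucl N} (h : MemW01p Ω p u V) (hp : (N : ℝ) < p) (hp1 : 1 < p) :
    ∀ᵐ x ∂(volume.restrict Ω), |u x| ≤
        morreyConst N p * (distBdry Ω x + N / p) * normL Ω p V := by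
  obtain ⟨φ, hφ, hae, a, ha, hle⟩ := h.exists_seq_tendsto hp hp1
  filter_upwards [hae] with x hx
  -- Test functions vanish at the nearest boundary point y, so Morrey's inequality between x and y
  -- bounds the value at x.
  obtain ⟨y, hy, hxy⟩ := hfr.exists_infDist_eq_dist hne x
  have hyΩ : y ∉ Ω := fun hy' => by
    rw [hΩ.frontier_eq] at hy; exact hy.2 hy'
  refine le_of_tendsto_of_tendsto' hx.abs (ha.const_mul _) fun n => ?_
  have := hle n x y
  rwa [(hφ n).eq_zero_of_notMem hyΩ, sub_zero, ← hxy] at this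

/-- Morrey's inequality for functions in `W_0^{1,p}(Ω)` continuous up to the boundary. -/
lemma MemW01p.morrey {N : ℕ} {Ω : Set (Eucl N)} (hΩ : IsOpen Ω) {p : ℝ} {u : Eucl N → ℝ}
    {V : Eucl N → Eucl N} (h : MemW01p Ω p u V) (hp : (N : ℝ) < p) (hp1 : 1 < p)
    (hu : ContinuousOn u (closure Ω)) :
    (∀ x ∈ closure Ω, ∀ y ∈ closure Ω,
      |u x - u y| ≤ morreyConst N p * (dist x y + N / p) * normL Ω p V) ∧
    (IsCompact (frontier Ω) → (frontier Ω).Nonempty → ∀ x ∈ closure Ω,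
      |u x| ≤ morreyConst N p * (distBdry Ω x + N / p) * normL Ω p V) := by
  obtain ⟨φ, hφ, hae, a, ha, hle⟩ := h.exists_seq_tendsto hp hp1
  -- Nonempty open sets have positive measure, so a property valid a.e. in Ω holds on a dense
  -- subset; continuity of u then extends the closed inequalities to the closure, one variable at a
  -- time.
  have dense : ∀ P : Eucl N → Prop, (∀ᵐ x ∂(volume.restrict Ω), P x) →
      closure Ω ⊆ closure {x | x ∈ Ω ∧ P x} := by
    intro P hP
    refine closure_minimal (fun x hx => ?_) isClosed_closure
    rw [mem_closure_iff_nhds]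
    intro t ht
    obtain ⟨s, hs, hso, hxs⟩ := mem_nhds_iff.1 (inter_mem ht (hΩ.mem_nhds hx))
    have hpos : volume s ≠ 0 := (hso.measure_pos volume ⟨x, hxs⟩).ne'
    rw [ae_restrict_iff' hΩ.measurableSet] at hP
    by_contra hcon
    refine hpos (measure_mono_null (fun z hz => ?_) hP)
    intro hz'
    exact hcon ⟨z, (hs hz).1, (hs hz).2, hz' (hs hz).2⟩
  constructor
  · set D := {x | x ∈ Ω ∧ Tendsto (fun n => φ n x) atTop (𝓝 (u x))}
    have hD := dense _ hae
    have hDc : D ⊆ closure Ω := fun x hx => subset_closure hx.1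
    have key : ∀ x ∈ D, ∀ y ∈ D,
        |u x - u y| ≤ morreyConst N p * (dist x y + N / p) * normL Ω p V := fun x hx y hy =>
      le_of_tendsto_of_tendsto' (hx.2.sub hy.2).abs (ha.const_mul _) fun n => hle n x y
    have step : ∀ x ∈ D, ∀ y ∈ closure Ω,
        |u x - u y| ≤ morreyConst N p * (dist x y + N / p) * normL Ω p V := by
      intro x hx y hy
      have : (𝓝[D] y).NeBot := mem_closure_iff_nhdsWithin_neBot.1 (hD hy)
      have huy : Tendsto u (𝓝[D] y) (𝓝 (u y)) := (hu y hy).mono_left (nhdsWithin_mono _ hDc)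
      have hr : Tendsto (fun y => morreyConst N p * (dist x y + N / p) * normL Ω p V)
          (𝓝[D] y) (𝓝 (morreyConst N p * (dist x y + N / p) * normL Ω p V)) :=
        (Continuous.tendsto (by fun_prop) y).mono_left inf_le_left
      exact le_of_tendsto_of_tendsto (tendsto_const_nhds.sub huy).abs hr
        (eventually_nhdsWithin_of_forall fun z hz => key x hx z hz)
    intro x hx y hy
    have : (𝓝[D] x).NeBot := mem_closure_iff_nhdsWithin_neBot.1 (hD hx)
    have hux : Tendsto u (𝓝[D] x) (𝓝 (u x)) := (hu x hx).mono_left (nhdsWithin_mono _ hDc)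
    have hr : Tendsto (fun x => morreyConst N p * (dist x y + N / p) * normL Ω p V)
        (𝓝[D] x) (𝓝 (morreyConst N p * (dist x y + N / p) * normL Ω p V)) :=
      (Continuous.tendsto (by fun_prop) x).mono_left inf_le_left
    exact le_of_tendsto_of_tendsto (hux.sub tendsto_const_nhds).abs hr
      (eventually_nhdsWithin_of_forall fun z hz => step z hz y hy)
  · intro hfr hne x hx
    have hDd := dense _ (h.abs_le_ae hΩ hfr hne hp hp1)
    set D := {x | x ∈ Ω ∧ |u x| ≤ morreyConst N p * (distBdry Ω x + N / p) * normL Ω p V}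
    have hDc : D ⊆ closure Ω := fun x hx => subset_closure hx.1
    have : (𝓝[D] x).NeBot := mem_closure_iff_nhdsWithin_neBot.1 (hDd hx)
    have hux : Tendsto u (𝓝[D] x) (𝓝 (u x)) := (hu x hx).mono_left (nhdsWithin_mono _ hDc)
    have hdc : Continuous (distBdry Ω) := Metric.continuous_infDist_pt _
    have hr : Tendsto (fun x => morreyConst N p * (distBdry Ω x + N / p) * normL Ω p V)
        (𝓝[D] x) (𝓝 (morreyConst N p * (distBdry Ω x + N / p) * normL Ω p V)) :=
      (Continuous.tendsto (by fun_prop) x).mono_left inf_le_left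
    exact le_of_tendsto_of_tendsto hux.abs hr (eventually_nhdsWithin_of_forall fun z hz => hz.2)

/-! ### Norms with varying exponent -/

lemma normL_eq_integral {N : ℕ} {Ω : Set (Eucl N)} {s : ℝ} (hs : 0 < s) {f : Eucl N → ℝ}
    (hf : MemLp f (ENNReal.ofReal s) (volume.restrict Ω)) :
    normL Ω s f = (∫ x in Ω, |f x| ^ s) ^ (1 / s) := by
  rw [normL, hf.eLpNorm_eq_integral_rpow_norm (by simpa using hs) (by simp),
    ENNReal.toReal_ofReal (Real.rpow_nonneg (integral_nonneg fun _ => by positivity) _),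
    ENNReal.toReal_ofReal hs.le, one_div]
  simp only [Real.norm_eq_abs]

lemma memLp_of_continuous {N : ℕ} {Ω : Set (Eucl N)} (hΩ : Bornology.IsBounded Ω)
    (hΩm : MeasurableSet Ω) {f : Eucl N → ℝ} (hf : Continuous f) (s : ENNReal) :
    MemLp f s (volume.restrict Ω) := by
  have : IsFiniteMeasure (volume.restrict Ω) := ⟨by simpa using hΩ.measure_lt_top⟩
  obtain ⟨M, hM⟩ := hΩ.isCompact_closure.exists_bound_of_continuousOn hf.continuousOn
  exact MemLp.of_bound hf.aestronglyMeasurable M ((ae_restrict_iff' hΩm).2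
    (Eventually.of_forall fun x hx => hM x (subset_closure hx)))

/-- Convergence of integrals of powers with converging exponents. -/
lemma tendsto_setIntegral_abs_rpow {N : ℕ} {Ω : Set (Eucl N)} (hΩ : Bornology.IsBounded Ω)
    (hΩm : MeasurableSet Ω) {f : ℝ → Eucl N → ℝ} {g : Eucl N → ℝ} {q : ℝ → ℝ} {r : ℝ}
    (hr : 0 < r) (hq : Tendsto q atTop (𝓝 r)) (hf : ∀ p, Continuous (f p)) {M : ℝ}
    (hM : ∀ᶠ p in atTop, ∀ x ∈ Ω, |f p x| ≤ M)
    (hfg : ∀ x ∈ Ω, Tendsto (fun p => f p x) atTop (𝓝 (g x))) :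
    Tendsto (fun p => ∫ x in Ω, |f p x| ^ q p) atTop (𝓝 (∫ x in Ω, |g x| ^ r)) := by
  have : IsFiniteMeasure (volume.restrict Ω) := ⟨by simpa using hΩ.measure_lt_top⟩
  have hqpos : ∀ᶠ p in atTop, 0 < q p := hq.eventually (lt_mem_nhds hr)
  have hqlt : ∀ᶠ p in atTop, q p < r + 1 := hq.eventually (gt_mem_nhds (by linarith))
  -- A base of at least 1 lets the exponent q p be raised to r + 1 in the dominating constant.
  refine tendsto_integral_filter_of_dominated_convergence (fun _ => (max M 1) ^ (r + 1)) ?_ ?_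
    (integrable_const _) ?_
  · filter_upwards [hqpos] with p hp
    exact ((hf p).abs.rpow_const fun _ => Or.inr hp.le).aestronglyMeasurable
  · filter_upwards [hqpos, hqlt, hM] with p hp hp' hMp
    rw [ae_restrict_iff' hΩm]
    refine Eventually.of_forall fun x hx => ?_
    rw [Real.norm_eq_abs, abs_of_nonneg (by positivity)]
    calc |f p x| ^ q p ≤ (max M 1) ^ q p :=
          Real.rpow_le_rpow (abs_nonneg _) ((hMp x hx).trans (le_max_left _ _)) hp.le
      _ ≤ (max M 1) ^ (r + 1) := Real.rpow_le_rpow_of_exponent_le (le_max_right _ _) hp'.le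
  · rw [ae_restrict_iff' hΩm]
    exact Eventually.of_forall fun x hx => (hfg x hx).abs.rpow hq (Or.inr hr)

lemma tendsto_normL {N : ℕ} {Ω : Set (Eucl N)} (hΩ : Bornology.IsBounded Ω)
    (hΩm : MeasurableSet Ω) {f : ℝ → Eucl N → ℝ} {g : Eucl N → ℝ} {q : ℝ → ℝ} {r : ℝ}
    (hr : 0 < r) (hq : Tendsto q atTop (𝓝 r)) (hf : ∀ p, Continuous (f p)) (hg : Continuous g)
    {M : ℝ} (hM : ∀ᶠ p in atTop, ∀ x ∈ Ω, |f p x| ≤ M)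
    (hfg : ∀ x ∈ Ω, Tendsto (fun p => f p x) atTop (𝓝 (g x))) :
    Tendsto (fun p => normL Ω (q p) (f p)) atTop (𝓝 (normL Ω r g)) := by
  have hqpos : ∀ᶠ p in atTop, 0 < q p := hq.eventually (lt_mem_nhds hr)
  rw [normL_eq_integral hr (memLp_of_continuous hΩ hΩm hg _)]
  have h1 := tendsto_setIntegral_abs_rpow hΩ hΩm hr hq hf hM hfg
  have h2 : Tendsto (fun p => 1 / q p) atTop (𝓝 (1 / r)) := tendsto_const_nhds.div hq hr.ne'
  refine (h1.rpow h2 (Or.inr (by positivity))).congr' ?_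
  filter_upwards [hqpos] with p hp
  rw [normL_eq_integral hp (memLp_of_continuous hΩ hΩm (hf p) _)]

/-! ### Competitors and the two bounds on λ -/

/-- A test function is in `W_0^{1,p}(Ω)`, its classical gradient being a weak gradient. -/
lemma IsTestFunction.memW01p {N : ℕ} {Ω : Set (Eucl N)} {φ : Eucl N → ℝ}
    (hφ : IsTestFunction Ω φ) (p : ℝ) : MemW01p Ω p φ (∇ φ) := by
  have hc := hφ.contDiff.continuous
  refine ⟨(hc.memLp_of_hasCompactSupport hφ.hasCompactSupport).restrict _,
    (hφ.continuous_gradient.memLp_of_hasCompactSupport hφ.hasCompactSupport_gradient).restrict _,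
    ⟨hc.locallyIntegrable.locallyIntegrableOn _,
      hφ.continuous_gradient.locallyIntegrable.locallyIntegrableOn _, fun ψ hψ => ?_⟩,
    fun _ => φ, fun _ => hφ, by simp, by simp⟩
  have hcψ := hψ.contDiff.continuous
  have hI1 : Integrable fun x => φ x • ∇ ψ x :=
    (hc.smul hψ.continuous_gradient).integrable_of_hasCompactSupport
      (hφ.hasCompactSupport.smul_right)
  have hI2 : Integrable fun x => ψ x • ∇ φ x :=
    (hcψ.smul hφ.continuous_gradient).integrable_of_hasCompactSupport
      (hψ.hasCompactSupport.smul_right)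
  rw [setIntegral_eq_integral_of_forall_compl_eq_zero
      (fun x hx => by rw [hφ.eq_zero_of_notMem hx, zero_smul]),
    setIntegral_eq_integral_of_forall_compl_eq_zero
      (fun x hx => by rw [hψ.eq_zero_of_notMem hx, zero_smul])]
  -- Pairing with a fixed vector v reduces the identity to scalar integration by parts in direction
  -- v.
  refine ext_inner_left ℝ fun v => ?_
  rw [inner_neg_right, ← integral_inner hI1, ← integral_inner hI2]
  have hgr : ∀ (f : Eucl N → ℝ) (x : Eucl N), inner ℝ v (∇ f x) = fderiv ℝ f x v := by
    intro f x
    rw [real_inner_comm, gradient, InnerProductSpace.toDual_symm_apply]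
  have e1 : ∀ x, inner ℝ v (φ x • ∇ ψ x) = φ x * fderiv ℝ ψ x v := fun x => by
    rw [inner_smul_right, hgr]
  have e2 : ∀ x, inner ℝ v (ψ x • ∇ φ x) = fderiv ℝ φ x v * ψ x := fun x => by
    rw [inner_smul_right, hgr, mul_comm]
  have hJ1 := hI1.const_inner (𝕜 := ℝ) v
  have hJ2 := hI2.const_inner (𝕜 := ℝ) v
  simp only [e1, e2] at hJ1 hJ2 ⊢
  refine integral_mul_fderiv_eq_neg_fderiv_mul_of_integrable hJ2 hJ1
    ((hc.mul hcψ).integrable_of_hasCompactSupport hφ.hasCompactSupport.mul_right) ?_ ?_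
  · exact fun x _ => hφ.contDiff.differentiable (by simp) x
  · exact fun x _ => hψ.contDiff.differentiable (by simp) x

/-- Test functions that are `1`-Lipschitz and uniformly close to the distance function. -/
lemma exists_isTestFunction_near_distBdry {N : ℕ} {Ω : Set (Eucl N)} (hΩ : IsOpen Ω)
    (hb : Bornology.IsBounded Ω) (huniv : Ω ≠ Set.univ) {ε : ℝ} (hε : 0 < ε) :
    ∃ φ : Eucl N → ℝ, IsTestFunction Ω φ ∧ (∀ x, ‖∇ φ x‖ ≤ 1) ∧
      ∀ x ∈ Ω, |φ x - distBdry Ω x| ≤ 3 * ε := by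
  have hne : Ωᶜ.Nonempty := Set.nonempty_compl.2 huniv
  -- Truncation at height 2ε makes f vanish within 2ε of the complement, so mollifying at scale ε
  -- leaves a support at distance at least ε from it. Truncation costs 2ε and mollification ε.
  set f : Eucl N → ℝ := fun x => max (Metric.infDist x Ωᶜ - 2 * ε) 0 with hf
  have hfL : LipschitzWith 1 f := by
    have h1 := Metric.lipschitz_infDist_pt (Ωᶜ : Set (Eucl N))
    refine LipschitzWith.of_dist_le_mul fun x y => ?_
    have := h1.dist_le_mul x y
    rw [Real.dist_eq] at this ⊢
    refine (abs_max_sub_max_le_abs _ _ _).trans ?_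
    simpa using this
  have hfc : Continuous f := hfL.continuous
  let ψ : ContDiffBump (0 : Eucl N) := ⟨ε / 2, ε, by positivity, by linarith⟩
  set φ := convolution (ψ.normed volume) f (ContinuousLinearMap.lsmul ℝ ℝ) volume with hφ
  have hnear : ∀ x, |φ x - f x| ≤ ε := by
    intro x
    rw [← Real.dist_eq]
    refine ψ.dist_normed_convolution_le hfc.aestronglyMeasurable fun y hy => ?_
    have := hfL.dist_le_mul y x
    have hy' : dist y x < ε := hy
    simp only [NNReal.coe_one, one_mul] at this
    linarith
  have hzero : ∀ x, Metric.infDist x Ωᶜ < ε → φ x = 0 := by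
    intro x hx
    have hy0 : ∀ y ∈ Metric.ball x ψ.rOut, f y = 0 := by
      intro y hy
      have hy' : dist y x < ε := hy
      have := Metric.infDist_le_infDist_add_dist (s := Ωᶜ) (x := y) (y := x)
      exact max_eq_right (by linarith)
    have hx0 : f x = 0 := hy0 x (Metric.mem_ball_self ψ.rOut_pos)
    have := ψ.dist_normed_convolution_le (μ := volume) (ε := 0) (x₀ := x)
      hfc.aestronglyMeasurable fun y hy => by rw [hy0 y hy, hx0, dist_self]
    rw [hx0] at this
    exact dist_le_zero.1 this
  have hsmooth : ContDiff ℝ ∞ φ :=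
    ψ.hasCompactSupport_normed.contDiff_convolution_left _ ψ.contDiff_normed
      hfc.locallyIntegrable
  have hsupp : tsupport φ ⊆ {x | ε ≤ Metric.infDist x Ωᶜ} := by
    refine closure_minimal (fun x hx => ?_)
      (isClosed_le continuous_const (Metric.continuous_infDist_pt _))
    by_contra hcon
    exact hx (hzero x (not_le.1 hcon))
  have hsub : {x | ε ≤ Metric.infDist x Ωᶜ} ⊆ Ω := by
    intro x hx
    by_contra hcon
    have : Metric.infDist x Ωᶜ = 0 := Metric.infDist_zero_of_mem hcon
    have hx' : ε ≤ Metric.infDist x Ωᶜ := hx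
    linarith
  have hLip : LipschitzWith 1 φ := by
    refine LipschitzWith.of_dist_le_mul fun x y => ?_
    have hI : ∀ x, Integrable fun t => ψ.normed volume t * f (x - t) := fun x =>
      (ψ.continuous_normed.mul (by fun_prop)).integrable_of_hasCompactSupport
        ψ.hasCompactSupport_normed.mul_right
    have e : ∀ x, φ x = ∫ t, ψ.normed volume t * f (x - t) := fun x => rfl
    rw [e, e, Real.dist_eq, ← integral_sub (hI x) (hI y), ← Real.norm_eq_abs]
    calc ‖∫ t, (ψ.normed volume t * f (x - t) - ψ.normed volume t * f (y - t))‖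
        ≤ ∫ t, ψ.normed volume t * dist x y := by
          refine norm_integral_le_of_norm_le
            (ψ.continuous_normed.integrable_of_hasCompactSupport
              ψ.hasCompactSupport_normed |>.mul_const _) (Eventually.of_forall fun t => ?_)
          rw [← mul_sub, norm_mul, Real.norm_eq_abs, abs_of_nonneg (ψ.nonneg_normed t)]
          refine mul_le_mul_of_nonneg_left ?_ (ψ.nonneg_normed t)
          have := hfL.dist_le_mul (x - t) (y - t)
          simpa [Real.dist_eq] using this
      _ = _ := by rw [integral_mul_const, ψ.integral_normed]; simp
  refine ⟨φ, ⟨hsmooth, ?_, hsupp.trans hsub⟩, fun x => ?_, fun x hx => ?_⟩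
  · exact Metric.isCompact_of_isClosed_isBounded (isClosed_tsupport _)
      (hb.subset (hsupp.trans hsub))
  · rw [norm_gradient_eq]
    exact_mod_cast norm_fderiv_le_of_lipschitz ℝ hLip
  -- Inside Ω the distances to the boundary and to the complement agree.
  · obtain ⟨y, hy, hxy⟩ := exists_mem_frontier_infDist_compl_eq_dist hx huniv
    have h1 : distBdry Ω x ≤ Metric.infDist x Ωᶜ := hxy ▸ Metric.infDist_le_dist_of_mem hy
    have h2 : Metric.infDist x Ωᶜ ≤ distBdry Ω x :=
      Metric.infDist_le_infDist_of_subset (by rw [hΩ.frontier_eq]; exact fun z hz => hz.2) ⟨y, hy⟩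
    have h3 := hnear x
    have h4 : |f x - distBdry Ω x| ≤ 2 * ε := by
      rw [h2.antisymm h1 |>.symm, hf]
      have : 0 ≤ Metric.infDist x Ωᶜ := Metric.infDist_nonneg
      rw [abs_le]
      constructor
      · linarith [le_max_left (Metric.infDist x Ωᶜ - 2 * ε) 0]
      · have := max_le (a := Metric.infDist x Ωᶜ - 2 * ε) (b := 0)
          (c := Metric.infDist x Ωᶜ + 2 * ε) (by linarith) (by linarith)
        linarith
    have := abs_sub_le (φ x) (f x) (distBdry Ω x)
    linarith

lemma normL_nonneg {N : ℕ} {F : Type*} [NormedAddCommGroup F] {Ω : Set (Eucl N)} {s : ℝ}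
    {f : Eucl N → F} : 0 ≤ normL Ω s f :=
  ENNReal.toReal_nonneg

lemma IsTestFunction.const_smul {N : ℕ} {Ω : Set (Eucl N)} {φ : Eucl N → ℝ}
    (hφ : IsTestFunction Ω φ) (c : ℝ) : IsTestFunction Ω (c • φ) :=
  ⟨hφ.contDiff.const_smul c, hφ.hasCompactSupport.smul_left (f := fun _ => c),
    (closure_mono (Function.support_const_smul_subset c φ)).trans hφ.tsupport_subset⟩

/-- The upper bound on `λ_{p,q}` given by a `1`-Lipschitz test function. -/
lemma IsTestFunction.sobolevConst_le {N : ℕ} {Ω : Set (Eucl N)} (hb : Bornology.IsBounded Ω)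
    {φ : Eucl N → ℝ} (hφ : IsTestFunction Ω φ) (h1 : ∀ x, ‖∇ φ x‖ ≤ 1) {p q : ℝ} (hp : 0 < p)
    (hc : 0 < normL Ω q φ) :
    (∃ (u : Eucl N → ℝ) (V : Eucl N → Eucl N), MemW01p Ω p u V ∧ normL Ω q u = 1) ∧
      sobolevConst Ω p q ^ (1 / p) ≤ volume.real Ω ^ (1 / p) * (normL Ω q φ)⁻¹ := by
  set c := normL Ω q φ with hcdef
  have hφc := hφ.const_smul c⁻¹
  have hmem := hφc.memW01p p
  have hnorm : normL Ω q (c⁻¹ • φ) = 1 := by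
    rw [normL, eLpNorm_const_smul, ENNReal.toReal_mul, ← normL, ← hcdef, toReal_enorm,
      Real.norm_eq_abs, abs_of_pos (inv_pos.2 hc), inv_mul_cancel₀ hc.ne']
  refine ⟨⟨_, _, hmem, hnorm⟩, ?_⟩
  have hgrad : ∀ x, ‖∇ (c⁻¹ • φ) x‖ ≤ c⁻¹ := by
    intro x
    rw [norm_gradient_eq, fderiv_const_smul (hφ.contDiff.differentiable (by simp) x), norm_smul,
      ← norm_gradient_eq, Real.norm_eq_abs, abs_of_pos (inv_pos.2 hc)]
    exact mul_le_of_le_one_right (inv_pos.2 hc).le (h1 x)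
  have hV : normL Ω p (∇ (c⁻¹ • φ)) ≤ volume.real Ω ^ (1 / p) * c⁻¹ := by
    have := eLpNorm_le_of_ae_bound (p := ENNReal.ofReal p) (μ := volume.restrict Ω)
      (Eventually.of_forall hgrad)
    have h2 := ENNReal.toReal_mono (ENNReal.mul_ne_top (ENNReal.rpow_ne_top_of_nonneg
      (by positivity) (by simpa using hb.measure_lt_top.ne)) ENNReal.ofReal_ne_top) this
    rwa [ENNReal.toReal_mul, ← ENNReal.toReal_rpow, ENNReal.toReal_ofReal (inv_pos.2 hc).le,
      ENNReal.toReal_ofReal hp.le, Measure.restrict_apply_univ, ← one_div (p : ℝ)] at h2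
  have hbdd : BddBelow {t : ℝ | ∃ (u : Eucl N → ℝ) (V : Eucl N → Eucl N),
      MemW01p Ω p u V ∧ normL Ω q u = 1 ∧ t = normL Ω p V ^ p} := by
    refine ⟨0, ?_⟩
    rintro t ⟨u, V, -, -, rfl⟩
    exact Real.rpow_nonneg normL_nonneg _
  have hle : sobolevConst Ω p q ≤ normL Ω p (∇ (c⁻¹ • φ)) ^ p :=
    csInf_le hbdd ⟨_, _, hmem, hnorm, rfl⟩
  have h0 : 0 ≤ sobolevConst Ω p q := by
    refine Real.sInf_nonneg ?_
    rintro t ⟨u, V, -, -, rfl⟩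
    exact Real.rpow_nonneg normL_nonneg _
  refine (Real.rpow_le_rpow h0 hle (by positivity)).trans ?_
  rwa [← Real.rpow_mul normL_nonneg, mul_one_div_cancel hp.ne', Real.rpow_one]

/-- The lower bound on `λ_{p,q}` given by Morrey's inequality. -/
lemma le_sobolevConst {N : ℕ} {Ω : Set (Eucl N)} (hΩ : IsOpen Ω) (hb : Bornology.IsBounded Ω)
    (hne : (frontier Ω).Nonempty) {p q : ℝ} (hp : (N : ℝ) < p) (hp1 : 1 < p)
    (hadm : ∃ (u : Eucl N → ℝ) (V : Eucl N → Eucl N), MemW01p Ω p u V ∧ normL Ω q u = 1)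
    (hn : 0 < normL Ω q (fun x => distBdry Ω x + N / p)) :
    (morreyConst N p * normL Ω q (fun x => distBdry Ω x + N / p))⁻¹ ≤
      sobolevConst Ω p q ^ (1 / p) := by
  have hp0 : 0 < p := by linarith
  have hK := morreyConst_pos hp
  have hfr : IsCompact (frontier Ω) :=
    hb.isCompact_closure.of_isClosed_subset isClosed_frontier frontier_subset_closure
  set n := normL Ω q (fun x => distBdry Ω x + N / p) with hndef
  have hd0 : ∀ x, 0 ≤ distBdry Ω x := fun x => Metric.infDist_nonneg
  have hdc : Continuous (distBdry Ω) := Metric.continuous_infDist_pt _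
  have key : ((morreyConst N p * n)⁻¹) ^ p ≤ sobolevConst Ω p q := by
    obtain ⟨u₀, V₀, hm₀, hn₀⟩ := hadm
    -- Nonemptiness is essential here: the real infimum of the empty set is 0 by convention.
    refine le_csInf ⟨_, u₀, V₀, hm₀, hn₀, rfl⟩ ?_
    rintro t ⟨u, V, hm, hu, rfl⟩
    have hV0 : 0 ≤ normL Ω p V := normL_nonneg
    refine Real.rpow_le_rpow (by positivity) ?_ hp0.le
    have hae := hm.abs_le_ae hΩ hfr hne hp hp1
    have hle := eLpNorm_le_mul_eLpNorm_of_ae_le_mul (p := ENNReal.ofReal q)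
      (μ := volume.restrict Ω) (f := u) (g := fun x => distBdry Ω x + N / p)
      (c := morreyConst N p * normL Ω p V) (by
        filter_upwards [hae] with x hx
        rw [Real.norm_eq_abs, Real.norm_eq_abs, abs_of_nonneg (a := distBdry Ω x + N / p)
          (by have := hd0 x; positivity)]
        linarith)
    have h2 := ENNReal.toReal_mono (ENNReal.mul_ne_top ENNReal.ofReal_ne_top
      (memLp_of_continuous hb hΩ.measurableSet (by fun_prop) _).2.ne) hle
    rw [ENNReal.toReal_mul, ENNReal.toReal_ofReal (by positivity), ← normL, ← normL, ← hndef,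
      hu] at h2
    rw [inv_le_iff_one_le_mul₀ (by positivity)]
    linarith
  have := Real.rpow_le_rpow (by positivity) key (z := 1 / p) (by positivity)
  rwa [← Real.rpow_mul (by positivity), mul_one_div_cancel hp0.ne', Real.rpow_one] at this

/-! ### Tools for the limits -/

lemma normL_distBdry_pos {N : ℕ} {Ω : Set (Eucl N)} (hΩ : IsOpen Ω) (hb : Bornology.IsBounded Ω)
    (hΩne : Ω.Nonempty) (hne : (frontier Ω).Nonempty) {r : ℝ} (hr : 0 < r) :
    0 < normL Ω r (distBdry Ω) := by
  have hdc : Continuous (distBdry Ω) := Metric.continuous_infDist_pt _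
  refine ENNReal.toReal_pos (fun h => ?_)
    (memLp_of_continuous hb hΩ.measurableSet hdc _).2.ne
  rw [eLpNorm_eq_zero_iff hdc.aestronglyMeasurable (by simpa using hr), EventuallyEq,
    ae_restrict_iff' hΩ.measurableSet] at h
  refine (hΩ.measure_pos volume hΩne).ne' (measure_mono_null (fun x hx => ?_) h)
  intro hx'
  have hfx : x ∉ frontier Ω := by rw [hΩ.frontier_eq]; exact fun h => h.2 hx
  exact ((isClosed_frontier.notMem_iff_infDist_pos hne).1 hfx).ne' (hx' hx)

/-- The distance from a point of Ω to the complement is attained on the boundary. Assuming x in the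
closure excludes exterior points, whose distance to the boundary is also positive. -/
lemma ball_subset_of_lt_distBdry {N : ℕ} {Ω : Set (Eucl N)} (hΩ : IsOpen Ω)
    (huniv : Ω ≠ Set.univ) {x : Eucl N} (hx : x ∈ closure Ω) {η : ℝ} (hη : 0 < η)
    (h : η ≤ distBdry Ω x) : Metric.ball x η ⊆ Ω := by
  have hxΩ : x ∈ Ω := by
    by_contra hcon
    have : x ∈ frontier Ω := by rw [hΩ.frontier_eq]; exact ⟨hx, hcon⟩
    rw [distBdry, Metric.infDist_zero_of_mem this] at h
    linarith
  intro y hy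
  by_contra hcon
  obtain ⟨z, hz, hxz⟩ := exists_mem_frontier_infDist_compl_eq_dist hxΩ huniv
  have h1 : distBdry Ω x ≤ dist x z := Metric.infDist_le_dist_of_mem hz
  have h2 : Metric.infDist x Ωᶜ ≤ dist x y := Metric.infDist_le_dist_of_mem hcon
  rw [Metric.mem_ball, dist_comm] at hy
  linarith

/-- The superadditivity of `t ↦ t ^ q` in integrated form. -/
lemma setIntegral_rpow_add_le {N : ℕ} {Ω B : Set (Eucl N)} (hΩm : MeasurableSet Ω)
    (hB : MeasurableSet B) (hBΩ : B ⊆ Ω) {u w : Eucl N → ℝ} {a q : ℝ} (hq : 1 ≤ q) (ha : 0 ≤ a)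
    (hu : MemLp u (ENNReal.ofReal q) (volume.restrict Ω))
    (hw : MemLp w (ENNReal.ofReal q) (volume.restrict Ω)) (hBfin : volume B ≠ ⊤)
    (hu0 : ∀ x ∈ Ω, 0 ≤ u x) (huw : ∀ x ∈ Ω, u x ≤ w x) (huB : ∀ x ∈ B, u x + a ≤ w x) :
    (∫ x in Ω, |u x| ^ q) + volume.real B * a ^ q ≤ ∫ x in Ω, |w x| ^ q := by
  have hq0 : 0 < q := by linarith
  have hI : ∀ {f : Eucl N → ℝ}, MemLp f (ENNReal.ofReal q) (volume.restrict Ω) →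
      IntegrableOn (fun x => |f x| ^ q) Ω := fun {f} hf => by
    have := hf.integrable_norm_rpow (by simpa using hq0) (by simp)
    rwa [ENNReal.toReal_ofReal hq0.le] at this
  have hind : Integrable (B.indicator fun _ => a ^ q) :=
    (integrable_indicator_iff hB).2 (integrableOn_const hBfin)
  have e : ∫ x in Ω, B.indicator (fun _ => a ^ q) x = volume.real B * a ^ q := by
    rw [setIntegral_indicator hB, Set.inter_eq_right.2 hBΩ, setIntegral_const, smul_eq_mul]
  rw [← e, ← integral_add (hI hu) hind.integrableOn]
  refine setIntegral_mono_on ((hI hu).add hind.integrableOn) (hI hw) hΩm fun x hx => ?_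
  have hw0 : 0 ≤ w x := (hu0 x hx).trans (huw x hx)
  rw [abs_of_nonneg (hu0 x hx), abs_of_nonneg hw0]
  by_cases hxB : x ∈ B
  · rw [Set.indicator_of_mem hxB]
    exact (Real.add_rpow_le_rpow_add (hu0 x hx) ha hq).trans
      (Real.rpow_le_rpow (add_nonneg (hu0 x hx) ha) (huB x hxB) hq0.le)
  · rw [Set.indicator_of_notMem hxB, add_zero]
    exact Real.rpow_le_rpow (hu0 x hx) (huw x hx) hq0.le

/-! ### The limits as p → ∞ -/

/-- The asymptotics of `λ_{p,q(p)}`. -/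
lemma tendsto_sobolevConst {N : ℕ} {Ω : Set (Eucl N)} (hΩ : IsOpen Ω)
    (hb : Bornology.IsBounded Ω) (hΩne : Ω.Nonempty) (huniv : Ω ≠ Set.univ)
    (hne : (frontier Ω).Nonempty) {q : ℝ → ℝ} {r : ℝ} (hr0 : 0 < r)
    (hr : Tendsto q atTop (𝓝 r)) :
    Tendsto (fun p : ℝ => sobolevConst Ω p (q p) ^ (1 / p)) atTop
      (𝓝 (normL Ω r (distBdry Ω))⁻¹) := by
  have hdc : Continuous (distBdry Ω) := Metric.continuous_infDist_pt _
  have hd0 : ∀ x, 0 ≤ distBdry Ω x := fun x => Metric.infDist_nonneg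
  have hpos := normL_distBdry_pos hΩ hb hΩne hne hr0
  obtain ⟨D, hD⟩ := hb.isCompact_closure.exists_bound_of_continuousOn hdc.continuousOn
  have hD' : ∀ x ∈ Ω, |distBdry Ω x| ≤ D := fun x hx => hD x (subset_closure hx)
  have hN : Tendsto (fun p : ℝ => (N : ℝ) / p) atTop (𝓝 0) :=
    tendsto_const_nhds.div_atTop tendsto_id
  have hε : Tendsto (fun p : ℝ => 3 * (1 / (|p| + 1))) atTop (𝓝 0) := by
    have : Tendsto (fun p : ℝ => 1 / (|p| + 1)) atTop (𝓝 0) :=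
      tendsto_const_nhds.div_atTop (tendsto_atTop_add_const_right _ _ tendsto_abs_atTop_atTop)
    simpa using this.const_mul 3
  -- The tolerance 1 / (|p| + 1) is positive for every real p and tends to 0.
  choose φ hφ hφ1 hφd using fun p : ℝ => exists_isTestFunction_near_distBdry hΩ hb huniv
    (ε := 1 / (|p| + 1)) (by positivity)
  have hnφ : Tendsto (fun p => normL Ω (q p) (φ p)) atTop (𝓝 (normL Ω r (distBdry Ω))) := by
    refine tendsto_normL hb hΩ.measurableSet hr0 hr (fun p => (hφ p).contDiff.continuous) hdc
      (M := D + 1) ?_ fun x hx => ?_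
    · filter_upwards [hε.eventually (gt_mem_nhds one_pos)] with p hp x hx
      have h1 := hφd p x hx
      have h2 := hD' x hx
      rw [abs_le] at h1 h2 ⊢
      constructor <;> linarith
    · rw [tendsto_iff_norm_sub_tendsto_zero]
      exact squeeze_zero (fun _ => norm_nonneg _) (fun p => hφd p x hx) hε
  have hnd : Tendsto (fun p : ℝ => normL Ω (q p) (fun x => distBdry Ω x + N / p)) atTop
      (𝓝 (normL Ω r (distBdry Ω))) := by
    refine tendsto_normL hb hΩ.measurableSet hr0 hr (fun p => by fun_prop) hdc
      (M := D + 1) ?_ fun x hx => ?_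
    · filter_upwards [hN.eventually (gt_mem_nhds one_pos), eventually_gt_atTop 0] with p hp hp0 x hx
      have h2 := hD' x hx
      have : 0 ≤ (N : ℝ) / p := by positivity
      rw [abs_le] at h2 ⊢
      constructor <;> linarith
    · simpa using hN.const_add (distBdry Ω x)
  have hup : Tendsto (fun p : ℝ => volume.real Ω ^ (1 / p) * (normL Ω (q p) (φ p))⁻¹) atTop
      (𝓝 (normL Ω r (distBdry Ω))⁻¹) := by
    have hv : 0 < volume.real Ω :=
      ENNReal.toReal_pos (hΩ.measure_pos volume hΩne).ne' hb.measure_lt_top.ne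
    have h0 : Tendsto (fun p : ℝ => 1 / p) atTop (𝓝 0) := tendsto_const_nhds.div_atTop tendsto_id
    have h1 : Tendsto (fun p : ℝ => volume.real Ω ^ (1 / p)) atTop (𝓝 1) := by
      simpa using (tendsto_const_nhds (x := volume.real Ω)).rpow h0 (Or.inl hv.ne')
    simpa using h1.mul (hnφ.inv₀ hpos.ne')
  have hlow : Tendsto (fun p : ℝ => (morreyConst N p *
      normL Ω (q p) (fun x => distBdry Ω x + N / p))⁻¹) atTop
      (𝓝 (normL Ω r (distBdry Ω))⁻¹) := by
    have := ((tendsto_morreyConst N).mul hnd).inv₀ (by simpa using hpos.ne')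
    simpa only [one_mul] using this
  have hev1 := hnφ.eventually (lt_mem_nhds hpos)
  have hev2 := hnd.eventually (lt_mem_nhds hpos)
  refine tendsto_of_tendsto_of_tendsto_of_le_of_le' hlow hup ?_ ?_
  · filter_upwards [hev1, hev2, eventually_gt_atTop (N : ℝ), eventually_gt_atTop 1]
      with p h1 h2 hpN hp1
    exact le_sobolevConst hΩ hb hne hpN hp1
      ((hφ p).sobolevConst_le hb (hφ1 p) (by linarith) h1).1 h2
  · filter_upwards [hev1, eventually_gt_atTop 1] with p h1 hp1
    exact ((hφ p).sobolevConst_le hb (hφ1 p) (by linarith) h1).2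

/-- The uniform convergence of the extremal functions. -/
lemma tendstoUniformlyOn_extremal {N : ℕ} {Ω : Set (Eucl N)} (hΩ : IsOpen Ω)
    (hb : Bornology.IsBounded Ω) (hΩne : Ω.Nonempty) (huniv : Ω ≠ Set.univ)
    (hne : (frontier Ω).Nonempty) {q : ℝ → ℝ} {r : ℝ} (hr0 : 0 < r)
    (hr : Tendsto q atTop (𝓝 r)) (hq : ∀ p : ℝ, (N : ℝ) < p → 1 ≤ q p)
    {u : ℝ → Eucl N → ℝ} (hu : ∀ p : ℝ, (N : ℝ) < p → IsSobolevExtremal Ω p (q p) (u p)) :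
    TendstoUniformlyOn u (fun x => distBdry Ω x / normL Ω r (distBdry Ω)) atTop (closure Ω) := by
  have hdc : Continuous (distBdry Ω) := Metric.continuous_infDist_pt _
  have hd0 : ∀ x, 0 ≤ distBdry Ω x := fun x => Metric.infDist_nonneg
  have hpos := normL_distBdry_pos hΩ hb hΩne hne hr0
  have hL := tendsto_sobolevConst hΩ hb hΩne huniv hne hr0 hr
  have hfr : IsCompact (frontier Ω) :=
    hb.isCompact_closure.of_isClosed_subset isClosed_frontier frontier_subset_closure
  obtain ⟨D, hD⟩ := hb.isCompact_closure.exists_bound_of_continuousOn hdc.continuousOn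
  have hD' : ∀ x ∈ closure Ω, distBdry Ω x ≤ D := fun x hx => (le_abs_self _).trans (hD x hx)
  have hD0 : 0 ≤ D := by
    obtain ⟨x, hx⟩ := hΩne
    exact (hd0 x).trans (hD' x (subset_closure hx))
  have hN : Tendsto (fun p : ℝ => (N : ℝ) / p) atTop (𝓝 0) :=
    tendsto_const_nhds.div_atTop tendsto_id
  set Λ := (normL Ω r (distBdry Ω))⁻¹ with hΛdef
  have hΛ : 0 < Λ := inv_pos.2 hpos
  -- By minimality this equals `morreyConst N p` times the norm of the gradient of u p, the slope in
  -- Morrey's inequality for the extremal.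
  set κ : ℝ → ℝ := fun p => morreyConst N p * sobolevConst Ω p (q p) ^ (1 / p) with hκdef
  have hκ : Tendsto κ atTop (𝓝 Λ) := by
    simpa only [one_mul] using (tendsto_morreyConst N).mul hL
  have hκN : Tendsto (fun p => κ p * (N / p)) atTop (𝓝 0) := by
    simpa using hκ.mul hN
  have hκD : Tendsto (fun p => |κ p - Λ| * D) atTop (𝓝 0) := by
    simpa using (hκ.sub_const Λ).abs.mul_const D
  set w : ℝ → Eucl N → ℝ := fun p x => κ p * (distBdry Ω x + N / p) with hwdef
  have hwlim : Tendsto (fun p => ∫ x in Ω, |w p x| ^ q p) atTop (𝓝 1) := by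
    have h1 : ∫ x in Ω, |Λ * distBdry Ω x| ^ r = 1 := by
      have h2 : ∀ x, |Λ * distBdry Ω x| ^ r = Λ ^ r * |distBdry Ω x| ^ r := fun x => by
        rw [abs_mul, abs_of_pos hΛ, Real.mul_rpow hΛ.le (abs_nonneg _)]
      have h3 := normL_eq_integral hr0 (memLp_of_continuous hb hΩ.measurableSet hdc _)
      have h4 : ∫ x in Ω, |distBdry Ω x| ^ r = normL Ω r (distBdry Ω) ^ r := by
        rw [h3, ← Real.rpow_mul (integral_nonneg fun _ => by positivity),
          one_div_mul_cancel hr0.ne', Real.rpow_one]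
      simp only [h2]
      rw [integral_const_mul, h4, ← Real.mul_rpow hΛ.le hpos.le, inv_mul_cancel₀ hpos.ne',
        Real.one_rpow]
    rw [← h1]
    refine tendsto_setIntegral_abs_rpow hb hΩ.measurableSet hr0 hr (fun p => by fun_prop)
      (M := Λ * D + 2) ?_ fun x hx => ?_
    · filter_upwards [hκN.eventually (gt_mem_nhds one_pos), hκD.eventually (gt_mem_nhds one_pos),
        eventually_gt_atTop (0 : ℝ), hκ.eventually (lt_mem_nhds hΛ)] with p h1 h2 hp h3 x hx
      have hx' := hD' x (subset_closure hx)
      have := hd0 x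
      rw [abs_of_nonneg (by positivity)]
      have : κ p * distBdry Ω x ≤ κ p * D := mul_le_mul_of_nonneg_left hx' h3.le
      have : (κ p - Λ) * D ≤ |κ p - Λ| * D := mul_le_mul_of_nonneg_right (le_abs_self _) hD0
      simp only [hwdef]
      linarith
    · simpa using hκ.mul (hN.const_add (distBdry Ω x))
  rw [Metric.tendstoUniformlyOn_iff]
  intro ε hε
  -- Chosen so that Λ η and κ p * η are both at most ε/8 once κ p < Λ + 1.
  set η := ε / (8 * (Λ + 1)) with hηdef
  have hη : 0 < η := by positivity
  have hηΛ : (Λ + 1) * η = ε / 8 := by rw [hηdef]; field_simp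
  have hm : 0 < volume.real (Metric.ball (0 : Eucl N) η) :=
    ENNReal.toReal_pos (Metric.measure_ball_pos _ _ hη).ne' measure_ball_lt_top.ne
  have hgap : Tendsto (fun p => 1 + volume.real (Metric.ball (0 : Eucl N) η) * (ε / 2) ^ q p) atTop
      (𝓝 (1 + volume.real (Metric.ball (0 : Eucl N) η) * (ε / 2) ^ r)) :=
    ((tendsto_const_nhds.rpow hr (Or.inl (by positivity))).const_mul _).const_add _
  have hgap' := hwlim.eventually_lt hgap (by
    have : 0 < volume.real (Metric.ball (0 : Eucl N) η) * (ε / 2) ^ r := by positivity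
    linarith)
  filter_upwards [hgap', hκN.eventually (gt_mem_nhds (show (0 : ℝ) < ε / 8 by positivity)),
    hκD.eventually (gt_mem_nhds (show (0 : ℝ) < ε / 8 by positivity)),
    hκ.eventually (gt_mem_nhds (show Λ < Λ + 1 by linarith)), hκ.eventually (lt_mem_nhds hΛ),
    eventually_gt_atTop (N : ℝ), eventually_gt_atTop (1 : ℝ)]
    with p hlt h1 h2 h3 h4 hpN hp1 x hx
  have hp0 : 0 < p := by linarith
  have hup := hu p hpN
  obtain ⟨V, hV, hVmin⟩ := hup.isMinimizer
  have hVeq : morreyConst N p * normL Ω p V = κ p := by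
    rw [hκdef]
    simp only
    rw [← hVmin, ← Real.rpow_mul normL_nonneg, mul_one_div_cancel hp0.ne', Real.rpow_one]
  obtain ⟨hm1, hm2⟩ := hV.morrey hΩ hpN hp1 hup.continuousOn
  have hosc : ∀ x ∈ closure Ω, ∀ y ∈ closure Ω, |u p x - u p y| ≤ κ p * (dist x y + N / p) := by
    intro x hx y hy
    rw [← hVeq]
    linarith [hm1 x hx y hy]
  have huw : ∀ x ∈ closure Ω, |u p x| ≤ w p x := by
    intro x hx
    simp only [hwdef]
    rw [← hVeq]
    linarith [hm2 hfr hne x hx]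
  have hκd : ∀ x ∈ closure Ω, |κ p * distBdry Ω x - Λ * distBdry Ω x| < ε / 8 := by
    intro x hx
    rw [← sub_mul, abs_mul, abs_of_nonneg (hd0 x)]
    exact (mul_le_mul_of_nonneg_left (hD' x hx) (abs_nonneg _)).trans_lt h2
  have hu0 : ∀ x ∈ closure Ω, 0 ≤ u p x := by
    intro x hx
    have : (𝓝[Ω] x).NeBot := mem_closure_iff_nhdsWithin_neBot.1 hx
    exact ge_of_tendsto ((hup.continuousOn x hx).mono_left (nhdsWithin_mono _ subset_closure))
      (eventually_nhdsWithin_of_forall fun z hz => (hup.pos z hz).le)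
  have hquot : distBdry Ω x / normL Ω r (distBdry Ω) = Λ * distBdry Ω x := by
    rw [hΛdef]; ring
  rw [hquot, dist_comm, Real.dist_eq, abs_lt]
  have hxw := (le_abs_self _).trans (huw x hx)
  simp only [hwdef] at hxw
  have hxκ := abs_lt.1 (hκd x hx)
  -- The upper bound is immediate from u p ≤ w p; the lower one is proved by contradiction.
  refine ⟨?_, by linarith [hxκ.2]⟩
  by_contra hcon
  rw [not_lt] at hcon
  -- Since u p ≥ 0, a deficit of ε forces Λ d(x) ≥ ε, which keeps x away from the boundary.
  have hηd : η ≤ distBdry Ω x := by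
    have h5 : ε ≤ Λ * distBdry Ω x := by linarith [hu0 x hx]
    by_contra h6
    have h7 : Λ * distBdry Ω x ≤ Λ * η := mul_le_mul_of_nonneg_left (not_le.1 h6).le hΛ.le
    linarith
  have hball := ball_subset_of_lt_distBdry hΩ huniv hx hη hηd
  have hΛη : Λ * η ≤ ε / 8 := by linarith
  have hmem : ∀ {f : Eucl N → ℝ}, ContinuousOn f (closure Ω) →
      MemLp f (ENNReal.ofReal (q p)) (volume.restrict Ω) := by
    intro f hf
    have : IsFiniteMeasure (volume.restrict Ω) := ⟨by simpa using hb.measure_lt_top⟩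
    obtain ⟨M, hM⟩ := hb.isCompact_closure.exists_bound_of_continuousOn hf
    exact MemLp.of_bound ((hf.mono subset_closure).aestronglyMeasurable hΩ.measurableSet) M
      ((ae_restrict_iff' hΩ.measurableSet).2
        (Eventually.of_forall fun x hx => hM x (subset_closure hx)))
  have hqp := hq p hpN
  -- On the ball the deficit ε at x loses at most four errors of ε/8, from κ p * dist y x, κ p *
  -- (N/p), the variation of Λ d, and κ p - Λ; ε/2 remains.
  have hint := setIntegral_rpow_add_le hΩ.measurableSet measurableSet_ball hball hqp
    (show 0 ≤ ε / 2 by positivity) (hmem hup.continuousOn)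
    (w := w p) (hmem (Continuous.continuousOn (by fun_prop))) measure_ball_lt_top.ne
    (fun y hy => hu0 y (subset_closure hy))
    (fun y hy => (le_abs_self _).trans (huw y (subset_closure hy))) (fun y hy => by
      have hyc : y ∈ closure Ω := subset_closure (hball hy)
      have hdy : dist y x < η := hy
      have e1 := (le_abs_self _).trans (hosc y hyc x hx)
      have e2 := abs_lt.1 (hκd y hyc)
      have e3 : distBdry Ω x ≤ distBdry Ω y + dist x y := Metric.infDist_le_infDist_add_dist
      rw [dist_comm] at e3
      have e4 : Λ * distBdry Ω x ≤ Λ * (distBdry Ω y + η) :=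
        mul_le_mul_of_nonneg_left (by linarith) hΛ.le
      have e5 : κ p * dist y x ≤ (Λ + 1) * η :=
        mul_le_mul h3.le hdy.le dist_nonneg (by linarith)
      have e6 : 0 ≤ κ p * (N / p) := by positivity
      simp only [hwdef]
      linarith [e2.1])
  have hone : ∫ x in Ω, |u p x| ^ q p = 1 := by
    have h5 := normL_eq_integral (by linarith) (hmem hup.continuousOn)
    rw [hup.norm_eq_one] at h5
    have h6 := congrArg (· ^ q p) h5
    rw [← Real.rpow_mul (integral_nonneg fun _ => by positivity),
      one_div_mul_cancel (by linarith), Real.rpow_one, Real.one_rpow] at h6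
    exact h6.symm
  -- Translation invariance makes the margin independent of x, so the threshold on p is uniform.
  rw [hone, Measure.real, Measure.addHaar_ball_center, ← Measure.real] at hint
  linarith

end SobolevExtremal

end

theorem proposition5 (N : ℕ) (hN : 2 ≤ N) (Ω : Set (SobolevExtremal.Eucl N))
    (hΩ_open : IsOpen Ω) (hΩ_conn : IsConnected Ω) (hΩ_bdd : Bornology.IsBounded Ω)
    (q : ℝ → ℝ) (hq : ∀ p : ℝ, (N : ℝ) < p → 1 ≤ q p)
    (r : ℝ) (hr : Tendsto q atTop (𝓝 r)) :
    Tendsto (fun p : ℝ => SobolevExtremal.sobolevConst Ω p (q p) ^ (1 / p)) atTop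
      (𝓝 (SobolevExtremal.normL Ω r (SobolevExtremal.distBdry Ω))⁻¹) ∧
    ∀ u : ℝ → SobolevExtremal.Eucl N → ℝ,
      (∀ p : ℝ, (N : ℝ) < p → SobolevExtremal.IsSobolevExtremal Ω p (q p) (u p)) →
      TendstoUniformlyOn u
        (fun x => SobolevExtremal.distBdry Ω x /
          SobolevExtremal.normL Ω r (SobolevExtremal.distBdry Ω))
        atTop (closure Ω) := by
  -- Positive dimension makes the space unbounded, so a bounded Ω is proper and has a nonempty
  -- boundary.
  have : Nonempty (Fin N) := ⟨⟨0, by omega⟩⟩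
  have hne : Ω.Nonempty := hΩ_conn.nonempty
  have huniv : Ω ≠ Set.univ := by
    rintro rfl
    exact NormedSpace.unbounded_univ ℝ (SobolevExtremal.Eucl N) hΩ_bdd
  have hfr : (frontier Ω).Nonempty := nonempty_frontier_iff.2 ⟨hne, huniv⟩
  have hr1 : 1 ≤ r := ge_of_tendsto hr ((eventually_gt_atTop (N : ℝ)).mono hq)
  have hr0 : 0 < r := by linarith
  exact ⟨SobolevExtremal.tendsto_sobolevConst hΩ_open hΩ_bdd hne huniv hfr hr0 hr, fun u hu =>
    SobolevExtremal.tendstoUniformlyOn_extremal hΩ_open hΩ_bdd hne huniv hfr hr0 hr hq hu⟩
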